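/- **Setting.** Let $(\breve N,\breve g)$ be a semi-Riemannian manifold with Levi-Civita connection $\breve\nabla$, and let $\breve J$ be a smooth $(1,1)$-tensor field on $\breve N$ such that, for some positive integers $p,q$, $\breve J^2=p\breve J+qI$, such that $\breve g(\breve JX,Y)=\breve g(X,\breve JY)$ for all vector fields $X,Y$, and such that $\breve\nabla\breve J=0$ (that is, $(\breve N,\breve g,\breve J)$ is a locally metallic semi-Riemannian manifold). Let $N$ be a lightlike submanifold of $\breve N$: an immersed submanifold whose radical distribution $\mathrm{Rad}(TN)=TN\cap TN^{\perp}$ has constant rank $r\ge 1$, together with a screen distribution $S(TN)$, where $TN=\mathrm{Rad}(TN)\oplus S(TN)$, a screen transversal bundle $S(TN^\perp)$, where $TN^\perp=\mathrm{Rad}(TN)\oplus S(TN^\perp)$, and a lightlike transversal bundle $\mathrm{ltr}(TN)$, that is, a totally isotropic bundle orthogonal to $S(TN)$ and $S(TN^\perp)$ with $T\breve N|_N=TN\oplus \mathrm{ltr}(TN)\oplus S(TN^\perp)$. Suppose that $N$ is radical screen transversal, that is, $\breve J\,\mathrm{Rad}(TN)\subset S(TN^\perp)$ and $\breve J S(TN)=S(TN)$.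 For $W,U\in\Gamma(TN)$ and $V\in\Gamma(S(TN^\perp))$ let $\nabla_WU$ and $h^s(W,U)$ be the components of $\breve\nabla_WU$ in $TN$ and in $S(TN^\perp)$, and let $-A_VW$ be the component of $\breve\nabla_WV$ in $TN$, with respect to this decomposition of $T\breve N|_N$. For $U\in\Gamma(\mathrm{Rad}(TN))$ let $-A^*_UW$ be the component of $\nabla_WU$ in $S(TN)$, with respect to $TN=\mathrm{Rad}(TN)\oplus S(TN)$. The distribution $\mathrm{Rad}(TN)$ *defines a totally geodesic foliation* if it is involutive and $\nabla_WU\in\Gamma(\mathrm{Rad}(TN))$ for all $W,U\in\Gamma(\mathrm{Rad}(TN))$. A vector field along $N$ *has no component* in a subbundle $D$ of $T\breve N|_N$ if it is $\breve g$-orthogonal to $D$. **Theorem.** $\mathrm{Rad}(TN)$ defines a totally geodesic foliation if and only if at least one of the following conditions holds: (i) $A_{\breve JU}W\in\Gamma(\mathrm{Rad}(TN))$ and $A^*_UW=0$ for all $W,U\in\Gamma(\mathrm{Rad}(TN))$; (ii) $A_{\breve JU}W=p\,A^*_UW$ for all $W,U\in\Gamma(\mathrm{Rad}(TN))$; (iii)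 $h^s(W,\breve JZ)$ has no component in $\breve J\,\mathrm{Rad}(TN)$, that is, $\breve g(h^s(W,\breve JZ),\breve JU)=0$, for all $W,U\in\Gamma(\mathrm{Rad}(TN))$ and $Z\in\Gamma(S(TN))$. -/

import Mathlib

open scoped Manifold ContDiff Topology

noncomputable section

namespace LightlikeGeometry

/-! Manifolds are modelled on finite-dimensional real vector spaces, without boundary: `F` is the
model space of the ambient manifold `M`, and `E` that of the submanifold `N`. -/

/-- The tangent space at `x` of a manifold `M` modelled on `F`. -/
abbrev Tan (F : Type*) [NormedAddCommGroup F] [NormedSpace ℝ F]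
    {M : Type*} [TopologicalSpace M] [ChartedSpace F M] (x : M) : Type _ :=
  TangentSpace 𝓘(ℝ, F) x

section Ambient

variable {F : Type*} [NormedAddCommGroup F] [NormedSpace ℝ F]
  {M : Type*} [TopologicalSpace M] [ChartedSpace F M] [IsManifold 𝓘(ℝ, F) ∞ M]

/-- A vector field on `M` that is differentiable at the point `x`. -/
def FieldDiffAt (X : Π y : M, Tan F y) (x : M) : Prop :=
  MDifferentiableAt 𝓘(ℝ, F) 𝓘(ℝ, F).tangent
    (fun y ↦ (⟨y, X y⟩ : TangentBundle 𝓘(ℝ, F) M)) x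

variable (F M) in
/-- A semi-Riemannian metric: a smooth field of symmetric nondegenerate bilinear forms. -/
structure SemiRiemannianMetric where
  /-- The bilinear form on each tangent space. -/
  form (x : M) : Tan F x →L[ℝ] Tan F x →L[ℝ] ℝ
  symm (x : M) (v w : Tan F x) : form x v w = form x w v
  nondegenerate (x : M) (v : Tan F x) (hv : ∀ w, form x v w = 0) : v = 0
  contMDiff : ContMDiff 𝓘(ℝ, F) (𝓘(ℝ, F).prod 𝓘(ℝ, F →L[ℝ] F →L[ℝ] ℝ)) ∞
    (fun x ↦ Bundle.TotalSpace.mk' (F →L[ℝ] F →L[ℝ] ℝ)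
      (E := fun x : M ↦ Tan F x →L[ℝ] Tan F x →L[ℝ] ℝ) x (form x))

variable (F M) in
/-- A smooth tensor field of type `(1,1)`. -/
structure EndomorphismField where
  /-- The endomorphism of each tangent space. -/
  endo (x : M) : Tan F x →L[ℝ] Tan F x
  contMDiff : ContMDiff 𝓘(ℝ, F) (𝓘(ℝ, F).prod 𝓘(ℝ, F →L[ℝ] F)) ∞
    (fun x ↦ Bundle.TotalSpace.mk' (F →L[ℝ] F)
      (E := fun x : M ↦ Tan F x →L[ℝ] Tan F x) x (endo x))

variable (F M) in
/-- Linear connections on `M`. On paper, `cov Y x (X x)` is `(∇_X Y)(x)`. -/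
abbrev Connection :=
  CovariantDerivative 𝓘(ℝ, F) F (fun x : M ↦ TangentSpace 𝓘(ℝ, F) x)

/-- `cov` is the Levi-Civita connection of `g`: it is torsion-free and metric. -/
structure IsLeviCivita (g : SemiRiemannianMetric F M) (cov : Connection F M) : Prop where
  torsion_free (X Y : Π y : M, Tan F y) (x : M) (hX : FieldDiffAt X x) (hY : FieldDiffAt Y x) :
    cov Y x (X x) - cov X x (Y x) = VectorField.mlieBracket 𝓘(ℝ, F) X Y x
  metric (X Y : Π y : M, Tan F y) (x : M) (hX : FieldDiffAt X x) (hY : FieldDiffAt Y x)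
    (v : Tan F x) :
    mvfderiv 𝓘(ℝ, F) (fun y ↦ g.form y (X y) (Y y)) x v
      = g.form x (cov X x v) (Y x) + g.form x (X x) (cov Y x v)

/-- `(g, J)` is a metallic semi-Riemannian structure: `J² = pJ + qI` for positive integers `p`
and `q`, and `g` is `J`-compatible. -/
structure IsMetallic (g : SemiRiemannianMetric F M) (J : EndomorphismField F M) (p q : ℕ) :
    Prop where
  p_pos : 0 < p
  q_pos : 0 < q
  sq_eq (x : M) (v : Tan F x) :
    J.endo x (J.endo x v) = (p : ℝ) • J.endo x v + (q : ℝ) • v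
  compatible (x : M) (v w : Tan F x) :
    g.form x (J.endo x v) w = g.form x v (J.endo x w)

/-- `J` is parallel: `∇_W (J U) = J (∇_W U)`. -/
def IsParallel (cov : Connection F M) (J : EndomorphismField F M) : Prop :=
  ∀ (U : Π y : M, Tan F y) (x : M), FieldDiffAt U x → ∀ w : Tan F x,
    cov (fun y ↦ J.endo y (U y)) x w = J.endo x (cov U x w)

end Ambient

section Along

variable {E : Type*} [NormedAddCommGroup E] [NormedSpace ℝ E]
  {N : Type*} [TopologicalSpace N] [ChartedSpace E N]
  {F : Type*} [NormedAddCommGroup F] [NormedSpace ℝ F]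
  {M : Type*} [TopologicalSpace M] [ChartedSpace F M] [IsManifold 𝓘(ℝ, F) ∞ M]

variable (E F) in
/-- The differential of `f : N → M` at `x`. -/
abbrev diff (f : N → M) (x : N) : Tan E x →L[ℝ] Tan F (f x) :=
  mfderiv 𝓘(ℝ, E) 𝓘(ℝ, F) f x

/-- `D` is a smooth vector subbundle of `f^*TM`: near every point it has a smooth frame. For
`f = id` these are the smooth distributions on `M`. -/
def IsSmoothSubbundle (f : N → M) (D : Π x : N, Submodule ℝ (Tan F (f x))) : Prop :=
  ∀ x₀ : N, ∃ U ∈ 𝓝 x₀, ∃ (k : ℕ) (s : Fin k → Π x : N, Tan F (f x)),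
    (∀ i, ContMDiffOn 𝓘(ℝ, E) 𝓘(ℝ, F).tangent ∞
      (fun x ↦ (⟨f x, s i x⟩ : TangentBundle 𝓘(ℝ, F) M)) U) ∧
    ∀ x ∈ U, LinearIndependent ℝ (fun i ↦ s i x) ∧
      Submodule.span ℝ (Set.range fun i ↦ s i x) = D x

/-- The components of the vector field `V` along `f` in the local trivialization of `TM` that is
given by the preferred chart at `f x`. -/
def localRep (f : N → M) (V : Π y : N, Tan F (f y)) (x : N) : N → F := fun y ↦
  (trivializationAt F (TangentSpace 𝓘(ℝ, F)) (f x)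
    (⟨f y, V y⟩ : TangentBundle 𝓘(ℝ, F) M)).2

/-- The covariant derivative at `x` of a vector field `V` along `f : N → M` for the connection that
`cov` induces on `f^*TM`. In the frame `e_i` given by the chart at `f x`, where
`V = ∑ V^i e_i ∘ f`, it is `w ↦ ∑ dV^i(w) e_i + ∑ V^i(x) ∇_{df w} e_i`. For the restriction of a
vector field on `M` it is the covariant derivative of that field, see `covAlong_comp`. -/
def covAlong (cov : Connection F M) (f : N → M) (V : Π y : N, Tan F (f y)) (x : N) :
    Tan E x →L[ℝ] Tan F (f x) :=
  ((trivializationAt F (TangentSpace 𝓘(ℝ, F)) (f x)).symmL ℝ (f x)).comp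
      (mvfderiv 𝓘(ℝ, E) (localRep f V x) x)
    + (cov (FiberBundle.extend F (V x)) (f x)).comp (diff E F f x)

theorem covAlong_comp [FiniteDimensional ℝ F] (cov : Connection F M) (f : N → M) (x : N)
    (hf : MDifferentiableAt 𝓘(ℝ, E) 𝓘(ℝ, F) f x) (V : Π y : M, Tan F y)
    (hV : FieldDiffAt V (f x)) (w : Tan E x) :
    covAlong cov f (fun y ↦ V (f y)) x w = cov V (f x) (diff E F f x w) := by
  set t := trivializationAt F (TangentSpace 𝓘(ℝ, F)) (f x) with ht
  have hx : f x ∈ t.baseSet := FiberBundle.mem_baseSet_trivializationAt F _ (f x)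
  let rep : (Π y : M, Tan F y) → M → F := fun σ y ↦ (t (⟨y, σ y⟩ : TangentBundle 𝓘(ℝ, F) M)).2
  have hrep {σ : Π y : M, Tan F y} (hσ : FieldDiffAt σ (f x)) :
      MDifferentiableAt 𝓘(ℝ, F) 𝓘(ℝ, F) (rep σ) (f x) :=
    (mdifferentiableAt_section (IB := 𝓘(ℝ, F)) (F := F) σ).1 hσ
  have hcongr {a b : M → F} (h : a =ᶠ[𝓝 (f x)] b) :
      mvfderiv 𝓘(ℝ, F) a (f x) = mvfderiv 𝓘(ℝ, F) b (f x) := by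
    ext v
    exact congrArg (fun T : F →L[ℝ] F ↦ T v) (h.mfderiv_eq (I := 𝓘(ℝ, F)) (I' := 𝓘(ℝ, F)))
  have hnhds : t.baseSet ∈ 𝓝 (f x) := t.open_baseSet.mem_nhds hx
  let Φ : (Π y : M, Tan F y) → (Tan F (f x) →L[ℝ] Tan F (f x)) := fun σ ↦
    cov σ (f x) - (t.symmL ℝ (f x)).comp (mvfderiv 𝓘(ℝ, F) (rep σ) (f x))
  have hΦ : TensorialAt 𝓘(ℝ, F) F Φ (f x) := by
    refine ⟨fun {c σ} hc hσ ↦ ?_, fun {σ τ} hσ hτ ↦ ?_⟩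
    · have h : rep (c • σ) =ᶠ[𝓝 (f x)] c • rep σ := by
        filter_upwards [hnhds] with y hy
        exact (t.linear ℝ hy).map_smul (c y) (σ y)
      have h1 : t.symmL ℝ (f x) (rep σ (f x)) = σ (f x) := by
        rw [t.symmL_apply hx]
        exact t.symm_proj_apply (⟨f x, σ (f x)⟩ : TangentBundle 𝓘(ℝ, F) M) hx
      ext v
      simp only [Φ, cov.isCovariantDerivativeOn.leibniz hσ hc, hcongr h,
        mvfderiv_smul hc (hrep hσ)]
      simp [h1, smul_sub]
    · have h : rep (σ + τ) =ᶠ[𝓝 (f x)] rep σ + rep τ := by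
        filter_upwards [hnhds] with y hy
        exact (t.linear ℝ hy).map_add (σ y) (τ y)
      ext v
      simp only [Φ, cov.isCovariantDerivativeOn.add hσ hτ, hcongr h,
        mvfderiv_add (hrep hσ) (hrep hτ)]
      simp
      abel
  have key := hΦ.pointwise hV
    (FiberBundle.mdifferentiableAt_extend 𝓘(ℝ, F) F (V (f x))) (by simp)
  have hconst : mvfderiv 𝓘(ℝ, F) (rep (FiberBundle.extend F (V (f x)))) (f x) = 0 := by
    rw [hcongr (b := fun _ ↦ (t (⟨f x, V (f x)⟩ : TangentBundle 𝓘(ℝ, F) M)).2), mvfderiv_const]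
    filter_upwards [hnhds] with y hy
    simp [rep, FiberBundle.extend, ← ht, hy]
  have hchain : mvfderiv 𝓘(ℝ, E) (localRep f (fun y ↦ V (f y)) x) x
      = (mvfderiv 𝓘(ℝ, F) (rep V) (f x)).comp (diff E F f x) :=
    mfderiv_comp (I := 𝓘(ℝ, E)) (I' := 𝓘(ℝ, F)) (I'' := 𝓘(ℝ, F)) x (hrep hV) hf
  have key' := congrArg (fun T ↦ T (diff E F f x w)) key
  simp only [Φ, hconst, ContinuousLinearMap.comp_zero, sub_zero] at key'
  rw [covAlong, hchain]
  simp only [add_apply, ContinuousLinearMap.comp_apply, ← key']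
  simp [ht]

end Along

section Submanifold

variable {E : Type*} [NormedAddCommGroup E] [NormedSpace ℝ E]
  {N : Type*} [TopologicalSpace N] [ChartedSpace E N] [IsManifold 𝓘(ℝ, E) ∞ N]
  {F : Type*} [NormedAddCommGroup F] [NormedSpace ℝ F]
  {M : Type*} [TopologicalSpace M] [ChartedSpace F M] [IsManifold 𝓘(ℝ, F) ∞ M]

/-- `W` is a smooth section of the distribution `D` on `N`, that is, `W ∈ Γ(D)`. -/
structure IsSection (D : Π x : N, Submodule ℝ (Tan E x)) (W : Π x : N, Tan E x) : Prop where
  contMDiff : ContMDiff 𝓘(ℝ, E) 𝓘(ℝ, E).tangent ∞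
    (fun x ↦ (⟨x, W x⟩ : TangentBundle 𝓘(ℝ, E) N))
  mem (x : N) : W x ∈ D x

variable (E) in
/-- The fibre at `x` of the normal bundle `TN^⊥` of `f : N → M`. -/
def normal (g : SemiRiemannianMetric F M) (f : N → M) (x : N) : Submodule ℝ (Tan F (f x)) where
  carrier := {u | ∀ v : Tan E x, g.form (f x) u (diff E F f x v) = 0}
  add_mem' ha hb v := by simp [ha v, hb v]
  zero_mem' v := by simp
  smul_mem' c _ ha v := by simp [ha v]

variable (E) in
/-- The fibre at `x` of the radical distribution `Rad(TN) = TN ∩ TN^⊥` of `f : N → M`, as a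
subspace of `T_xN`. -/
def radical (g : SemiRiemannianMetric F M) (f : N → M) (x : N) : Submodule ℝ (Tan E x) :=
  (normal E g f x).comap (diff E F f x).toLinearMap

variable (E N) in
/-- A lightlike submanifold of `(M, g)`: a smooth immersion `f : N → M` whose radical distribution
has constant positive rank, with a screen distribution `S(TN)`, a screen transversal bundle
`S(TN^⊥)` and a lightlike transversal bundle `ltr(TN)`. -/
structure LightlikeSubmanifold (g : SemiRiemannianMetric F M) where
  /-- The immersion of `N` into `M`. -/
  f : N → M
  contMDiff : ContMDiff 𝓘(ℝ, E) 𝓘(ℝ, F) ∞ f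
  injective_diff (x : N) : Function.Injective (diff E F f x)
  /-- The rank of the radical distribution. -/
  r : ℕ
  r_pos : 1 ≤ r
  finrank_radical (x : N) : Module.finrank ℝ (radical E g f x) = r
  /-- The screen distribution, a complement of `Rad(TN)` in `TN`. -/
  screen (x : N) : Submodule ℝ (Tan E x)
  smooth_screen : IsSmoothSubbundle (E := E) (F := E) (id : N → N) screen
  isCompl_screen (x : N) : IsCompl (radical E g f x) (screen x)
  /-- The screen transversal bundle, a complement of `Rad(TN)` in `TN^⊥`. -/
  screenTr (x : N) : Submodule ℝ (Tan F (f x))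
  smooth_screenTr : IsSmoothSubbundle (E := E) f screenTr
  disjoint_screenTr (x : N) :
    Disjoint ((radical E g f x).map (diff E F f x).toLinearMap) (screenTr x)
  sup_screenTr (x : N) :
    (radical E g f x).map (diff E F f x).toLinearMap ⊔ screenTr x
      = normal E g f x
  /-- The lightlike transversal bundle. It is isotropic and orthogonal to `S(TN)` and
  `S(TN^⊥)`, so that it is in duality with `Rad(TN)`. -/
  ltr (x : N) : Submodule ℝ (Tan F (f x))
  smooth_ltr : IsSmoothSubbundle (E := E) f ltr
  ltr_isotropic (x : N) (u v : Tan F (f x)) (hu : u ∈ ltr x) (hv : v ∈ ltr x) :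
    g.form (f x) u v = 0
  ltr_screen (x : N) (u : Tan F (f x)) (hu : u ∈ ltr x) (z : Tan E x) (hz : z ∈ screen x) :
    g.form (f x) u (diff E F f x z) = 0
  ltr_screenTr (x : N) (u v : Tan F (f x)) (hu : u ∈ ltr x) (hv : v ∈ screenTr x) :
    g.form (f x) u v = 0
  disjoint_ltr (x : N) : Disjoint (ltr x) (screenTr x)
  /-- `TM|_N = TN ⊕ tr(TN)`, where `tr(TN) = ltr(TN) ⊕ S(TN^⊥)`. -/
  isCompl_tr (x : N) :
    IsCompl (LinearMap.range (diff E F f x).toLinearMap) (ltr x ⊔ screenTr x)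

namespace LightlikeSubmanifold

variable {g : SemiRiemannianMetric F M} (L : LightlikeSubmanifold E N g)

/-- The distribution `Rad(TN)`. -/
abbrev rad (x : N) : Submodule ℝ (Tan E x) := radical E g L.f x

/-- The differential of the immersion, as a linear map. -/
abbrev df (x : N) : Tan E x →ₗ[ℝ] Tan F (L.f x) :=
  (diff E F L.f x).toLinearMap

theorem isCompl_screenTr (x : N) :
    IsCompl (L.screenTr x) (LinearMap.range (L.df x) ⊔ L.ltr x) := by
  have h := L.isCompl_tr x
  refine ⟨?_, ?_⟩
  · rw [sup_comm]
    exact (L.disjoint_ltr x).symm.disjoint_sup_right_of_disjoint_sup_left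
      (by rw [sup_comm]; exact h.symm.disjoint)
  · rw [codisjoint_iff, ← h.sup_eq_top, sup_comm, sup_assoc]

/-- The tangential component of a vector of `T_{f x}M` for `TM|_N = TN ⊕ tr(TN)`. -/
def tanPart (x : N) : Tan F (L.f x) →ₗ[ℝ] Tan E x :=
  (LinearEquiv.ofInjective (L.df x) (L.injective_diff x)).symm.toLinearMap ∘ₗ
    Submodule.projectionOnto _ _ (L.isCompl_tr x)

/-- The `S(TN^⊥)`-component of a vector of `T_{f x}M` for
`TM|_N = TN ⊕ ltr(TN) ⊕ S(TN^⊥)`. -/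
def screenTrPart (x : N) : Tan F (L.f x) →ₗ[ℝ] Tan F (L.f x) :=
  Submodule.projection _ _ (L.isCompl_screenTr x)

/-- The projection `P` of `TN = Rad(TN) ⊕ S(TN)` onto `S(TN)`. -/
def screenPart (x : N) : Tan E x →ₗ[ℝ] Tan E x :=
  Submodule.projection _ _ (L.isCompl_screen x).symm

/-- A vector field on `N`, regarded as a vector field along the immersion. -/
def push (U : Π x : N, Tan E x) (x : N) : Tan F (L.f x) := diff E F L.f x (U x)

variable (cov : Connection F M)

/-- The induced connection: `∇_W U` is the `TN`-component of the ambient derivative of `U`. -/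
def indConn (W U : Π x : N, Tan E x) (x : N) : Tan E x :=
  L.tanPart x (covAlong cov L.f (L.push U) x (W x))

/-- The shape operator: `A_V W` is minus the `TN`-component of the ambient derivative in the
direction `W` of the transversal vector field `V`. -/
def shape (V : Π x : N, Tan F (L.f x)) (W : Π x : N, Tan E x) (x : N) : Tan E x :=
  -L.tanPart x (covAlong cov L.f V x (W x))

/-- The screen second fundamental form: `h^s(W, V)` is the `S(TN^⊥)`-component of the ambient
derivative in the direction `W` of the tangent vector field `V`, which is given as a vector field
along the immersion. -/
def hs (W : Π x : N, Tan E x) (V : Π x : N, Tan F (L.f x)) (x : N) : Tan F (L.f x) :=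
  L.screenTrPart x (covAlong cov L.f V x (W x))

/-- The shape operator of the screen distribution: `A*_U W` is minus the `S(TN)`-component of
`∇_W U`, for `U` in `Γ(Rad(TN))`. -/
def shapeStar (U W : Π x : N, Tan E x) (x : N) : Tan E x :=
  -L.screenPart x (L.indConn cov W U x)

/-- `Rad(TN)` defines a totally geodesic foliation of `N`: it is involutive, and `∇_W U` is in
`Γ(Rad(TN))` for all `W, U ∈ Γ(Rad(TN))`, so that its leaves are totally geodesic. -/
structure RadTotallyGeodesicFoliation : Prop where
  involutive (W U : Π x : N, Tan E x) (hW : IsSection L.rad W) (hU : IsSection L.rad U) (x : N) :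
    VectorField.mlieBracket 𝓘(ℝ, E) W U x ∈ L.rad x
  geodesic (W U : Π x : N, Tan E x) (hW : IsSection L.rad W) (hU : IsSection L.rad U) (x : N) :
    L.indConn cov W U x ∈ L.rad x

variable (J : EndomorphismField F M)

/-- `J U`, as a vector field along the immersion, for a vector field `U` on `N`. -/
def endoPush (U : Π x : N, Tan E x) (x : N) : Tan F (L.f x) := J.endo (L.f x) (L.push U x)

/-- The fibre of `J Rad(TN)`. -/
def endoRad (x : N) : Submodule ℝ (Tan F (L.f x)) :=
  ((L.rad x).map (L.df x)).map (J.endo (L.f x)).toLinearMap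

/-- `N` is a radical screen transversal lightlike submanifold: `J Rad(TN) ⊆ S(TN^⊥)` and
`J S(TN) = S(TN)`. -/
structure IsRadicalScreenTransversal : Prop where
  rad_le (x : N) : L.endoRad J x ≤ L.screenTr x
  screen_eq (x : N) :
    ((L.screen x).map (L.df x)).map (J.endo (L.f x)).toLinearMap
      = (L.screen x).map (L.df x)

/-- A vector `v` of `T_{f x}M` has no component in the subspace `D`, in the metric sense: it is
orthogonal to `D`. -/
def NoComponent (x : N) (v : Tan F (L.f x)) (D : Submodule ℝ (Tan F (L.f x))) : Prop :=
  ∀ u ∈ D, g.form (L.f x) v u = 0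

end LightlikeSubmanifold

end Submanifold

end LightlikeGeometry

/-! For radical sections `W`, `U` and a screen vector `z`, put ω(z) = g(∇̃_W U, z), where ∇̃ is the
ambient derivative along the immersion. Everything in the theorem is a statement about ω. Since
Rad(TN) is orthogonal to TN, a tangent vector is radical exactly when it is orthogonal to the screen
(`mem_rad_iff`), so the geodesic condition says ω = 0 for all `W`, `U`. Involutivity is then
automatic, because the bracket is a difference of two such derivatives
(`radTotallyGeodesicFoliation_iff`).

The operators in (i)-(iii) pair with the screen, or with J Rad(TN), as follows: A*_U W gives -ω(z)
(`form_shapeStar`); A_{JU} W gives -ω(Jz), as J is parallel and self-adjoint (`form_shape`); and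
h^s(W, JZ) against JU gives -ω(J²Z), by differentiating g(JZ, JU) = 0 (`form_hs`).

Since J maps the screen onto itself, ω = 0 yields (i). Conversely, (i) contains ω = 0. Condition
(ii) reads ω(Jz) = pω(z); at Jz it becomes ω(J²z) = pω(Jz), and J² = pJ + q leaves qω(z) = 0 with q
> 0. Condition (iii) reads ω ∘ J² = 0 on the screen, where J² is onto.

The analytic input is that the connection induced on f^*TM is metric (`mvfderiv_form`), torsion-free
(`covAlong_sub_covAlong`) and keeps J parallel (`covAlong_endo`). -/

namespace LightlikeGeometry

/-! ### Calculus of vector fields along a map: Leibniz rule, metricity, parallel J. -/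

section AlongCalculus

variable {E : Type*} [NormedAddCommGroup E] [NormedSpace ℝ E]
  {N : Type*} [TopologicalSpace N] [ChartedSpace E N]
  {F : Type*} [NormedAddCommGroup F] [NormedSpace ℝ F]
  {M : Type*} [TopologicalSpace M] [ChartedSpace F M] [IsManifold 𝓘(ℝ, F) ∞ M]

variable (E) in
/-- The vector field `V` along `f : N → M` is differentiable at the point `x`. -/
def AlongDiffAt (f : N → M) (V : Π y : N, Tan F (f y)) (x : N) : Prop :=
  MDifferentiableAt 𝓘(ℝ, E) 𝓘(ℝ, F).tangent
    (fun y ↦ (⟨f y, V y⟩ : TangentBundle 𝓘(ℝ, F) M)) x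

variable {f : N → M} {V V' : Π y : N, Tan F (f y)} {x : N}

theorem alongDiffAt_iff :
    AlongDiffAt E f V x ↔ MDifferentiableAt 𝓘(ℝ, E) 𝓘(ℝ, F) f x ∧
      MDifferentiableAt 𝓘(ℝ, E) 𝓘(ℝ, F) (localRep f V x) x :=
  mdifferentiableAt_totalSpace (IB := 𝓘(ℝ, F)) (F := F) _

theorem mvfderiv_congr {G : Type*} [NormedAddCommGroup G] [NormedSpace ℝ G] {a b : N → G}
    (h : a =ᶠ[𝓝 x] b) : mvfderiv 𝓘(ℝ, E) a x = mvfderiv 𝓘(ℝ, E) b x := by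
  ext v
  exact congrArg (fun T : E →L[ℝ] G ↦ T v) (h.mfderiv_eq (I := 𝓘(ℝ, E)) (I' := 𝓘(ℝ, G)))

theorem covAlong_congr (cov : Connection F M) (h : ∀ᶠ y in 𝓝 x, V y = V' y) :
    covAlong (E := E) cov f V x = covAlong cov f V' x := by
  have h1 : localRep f V x =ᶠ[𝓝 x] localRep f V' x := by
    filter_upwards [h] with y hy
    rw [localRep, localRep, hy]
  rw [covAlong, covAlong, mvfderiv_congr h1, h.self_of_nhds]

theorem eventually_mem_baseSet (hf : MDifferentiableAt 𝓘(ℝ, E) 𝓘(ℝ, F) f x) :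
    ∀ᶠ y in 𝓝 x, f y ∈ (trivializationAt F (TangentSpace 𝓘(ℝ, F)) (f x)).baseSet :=
  hf.continuousAt.preimage_mem_nhds <|
    (trivializationAt F (TangentSpace 𝓘(ℝ, F)) (f x)).open_baseSet.mem_nhds
      (FiberBundle.mem_baseSet_trivializationAt F _ (f x))

theorem localRep_add (hf : MDifferentiableAt 𝓘(ℝ, E) 𝓘(ℝ, F) f x) :
    localRep f (fun y ↦ V y + V' y) x =ᶠ[𝓝 x] localRep f V x + localRep f V' x := by
  filter_upwards [eventually_mem_baseSet hf] with y hy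
  exact ((trivializationAt F (TangentSpace 𝓘(ℝ, F)) (f x)).linear ℝ hy).map_add (V y) (V' y)

theorem localRep_smul (hf : MDifferentiableAt 𝓘(ℝ, E) 𝓘(ℝ, F) f x) (c : N → ℝ) :
    localRep f (fun y ↦ c y • V y) x =ᶠ[𝓝 x] c • localRep f V x := by
  filter_upwards [eventually_mem_baseSet hf] with y hy
  exact ((trivializationAt F (TangentSpace 𝓘(ℝ, F)) (f x)).linear ℝ hy).map_smul (c y) (V y)

theorem symmL_localRep_self {N : Type*} {f : N → M} {V : Π y : N, Tan F (f y)} {x : N} :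
    (trivializationAt F (TangentSpace 𝓘(ℝ, F)) (f x)).symmL ℝ (f x) (localRep f V x x) = V x := by
  have hx := FiberBundle.mem_baseSet_trivializationAt F (TangentSpace 𝓘(ℝ, F)) (f x)
  rw [Bundle.Trivialization.symmL_apply _ hx]
  exact Bundle.Trivialization.symm_proj_apply _ (⟨f x, V x⟩ : TangentBundle 𝓘(ℝ, F) M) hx

theorem AlongDiffAt.add (hV : AlongDiffAt E f V x) (hV' : AlongDiffAt E f V' x) :
    AlongDiffAt E f (fun y ↦ V y + V' y) x := by
  rw [alongDiffAt_iff] at *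
  exact ⟨hV.1, (hV.2.add hV'.2).congr_of_eventuallyEq (localRep_add hV.1)⟩

theorem AlongDiffAt.smul (hV : AlongDiffAt E f V x) {c : N → ℝ}
    (hc : MDifferentiableAt 𝓘(ℝ, E) 𝓘(ℝ, ℝ) c x) :
    AlongDiffAt E f (fun y ↦ c y • V y) x := by
  rw [alongDiffAt_iff] at *
  exact ⟨hV.1, (hc.smul hV.2).congr_of_eventuallyEq (localRep_smul hV.1 c)⟩

/-- The derivative at `m` of the extension of a tangent vector is additive in that vector. -/
theorem cov_extend_add (cov : Connection F M) {m : M} (v w : Tan F m) :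
    cov (FiberBundle.extend F (v + w)) m
      = cov (FiberBundle.extend F v) m + cov (FiberBundle.extend F w) m := by
  have hd (u : Tan F m) := FiberBundle.mdifferentiableAt_extend 𝓘(ℝ, F) F u
  have hm := FiberBundle.mem_baseSet_trivializationAt F (TangentSpace 𝓘(ℝ, F)) m
  rw [← cov.isCovariantDerivativeOn.add (hd v) (hd w)]
  refine cov.isCovariantDerivativeOn.congr_of_eventuallyEq (hd _)
    (mdifferentiableAt_add_section (hd v) (hd w)) Filter.univ_mem ?_
  filter_upwards [(trivializationAt F (TangentSpace 𝓘(ℝ, F)) m).open_baseSet.mem_nhds hm] with y hy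
  have h := ((trivializationAt F (TangentSpace 𝓘(ℝ, F)) m).linear ℝ hm).map_add v w
  simp only [FiberBundle.extend, Pi.add_apply]
  erw [h, ← Bundle.Trivialization.coe_symmₗ (R := ℝ) _ hy, map_add]

theorem cov_extend_smul (cov : Connection F M) {m : M} (c : ℝ) (v : Tan F m) :
    cov (FiberBundle.extend F (c • v)) m = c • cov (FiberBundle.extend F v) m := by
  have hd (u : Tan F m) := FiberBundle.mdifferentiableAt_extend 𝓘(ℝ, F) F u
  have hm := FiberBundle.mem_baseSet_trivializationAt F (TangentSpace 𝓘(ℝ, F)) m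
  have hl := cov.isCovariantDerivativeOn.leibniz (g := fun _ ↦ c) (hd v) mdifferentiableAt_const
  rw [mvfderiv_const] at hl
  trans cov ((fun _ : M ↦ c) • FiberBundle.extend F v) m
  · refine cov.isCovariantDerivativeOn.congr_of_eventuallyEq (hd _)
      (mdifferentiableAt_const.smul_section (hd v)) Filter.univ_mem ?_
    filter_upwards [(trivializationAt F (TangentSpace 𝓘(ℝ, F)) m).open_baseSet.mem_nhds hm]
      with y hy
    have h := ((trivializationAt F (TangentSpace 𝓘(ℝ, F)) m).linear ℝ hm).map_smul c v
    simp only [FiberBundle.extend]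
    erw [h, ← Bundle.Trivialization.coe_symmₗ (R := ℝ) _ hy, map_smul]
    change _ = c • (trivializationAt F (TangentSpace 𝓘(ℝ, F)) m).symm y _
    erw [← Bundle.Trivialization.coe_symmₗ (R := ℝ) _ hy]
  · refine hl.trans ?_
    ext u
    simp

theorem covAlong_add (cov : Connection F M) (hV : AlongDiffAt E f V x)
    (hV' : AlongDiffAt E f V' x) (w : Tan E x) :
    covAlong cov f (fun y ↦ V y + V' y) x w = covAlong cov f V x w + covAlong cov f V' x w := by
  rw [alongDiffAt_iff] at hV hV'
  simp only [covAlong, mvfderiv_congr (localRep_add hV.1), mvfderiv_add hV.2 hV'.2, cov_extend_add,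
    add_apply,
    ContinuousLinearMap.comp_apply, map_add]
  abel

/-- Only the derivative of the components produces a Leibniz term; the connection term depends
linearly on the value `V x` alone. -/
theorem covAlong_smul (cov : Connection F M) (hV : AlongDiffAt E f V x) {c : N → ℝ}
    (hc : MDifferentiableAt 𝓘(ℝ, E) 𝓘(ℝ, ℝ) c x) (w : Tan E x) :
    covAlong cov f (fun y ↦ c y • V y) x w
      = c x • covAlong cov f V x w + mvfderiv 𝓘(ℝ, E) c x w • V x := by
  rw [alongDiffAt_iff] at hV
  simp only [covAlong, mvfderiv_congr (localRep_smul hV.1 c), mvfderiv_smul hc hV.2,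
    cov_extend_smul, add_apply,
    ContinuousLinearMap.comp_apply, smul_apply, map_add, map_smul, smul_add,
    ContinuousLinearMap.smulRight_apply, symmL_localRep_self]
  abel

theorem AlongDiffAt.restrict (hf : MDifferentiableAt 𝓘(ℝ, E) 𝓘(ℝ, F) f x)
    {X : Π y : M, Tan F y} (hX : FieldDiffAt X (f x)) : AlongDiffAt E f (fun y ↦ X (f y)) x :=
  MDifferentiableAt.comp (g := fun m ↦ (⟨m, X m⟩ : TangentBundle 𝓘(ℝ, F) M)) x hX hf

/-- A property of vector fields along `f` that is local, stable under sums and products with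
functions, and true for restrictions of vector fields on `M`, holds for all differentiable fields. -/
theorem AlongDiffAt.induction [FiniteDimensional ℝ F] {P : (Π y : N, Tan F (f y)) → Prop}
    (restrict : ∀ X : Π y : M, Tan F y, FieldDiffAt X (f x) → P fun y ↦ X (f y))
    (add : ∀ V V' : Π y : N, Tan F (f y), AlongDiffAt E f V x → AlongDiffAt E f V' x →
      P V → P V' → P fun y ↦ V y + V' y)
    (smul : ∀ (c : N → ℝ) (V : Π y : N, Tan F (f y)), MDifferentiableAt 𝓘(ℝ, E) 𝓘(ℝ, ℝ) c x →
      AlongDiffAt E f V x → P V → P fun y ↦ c y • V y)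
    (congr : ∀ V V' : Π y : N, Tan F (f y), (∀ᶠ y in 𝓝 x, V y = V' y) → P V → P V')
    (hV : AlongDiffAt E f V x) : P V := by
  have hf := (alongDiffAt_iff.1 hV).1
  have hr := (alongDiffAt_iff.1 hV).2
  let b := Module.finBasis ℝ F
  set t := trivializationAt F (TangentSpace 𝓘(ℝ, F)) (f x) with ht
  have hx : f x ∈ t.baseSet := FiberBundle.mem_baseSet_trivializationAt F _ (f x)
  -- The local frame with constant components: near `x` the field is a combination of its
  -- restrictions. Each `e i` is the extension of its own value at `f x`, hence differentiable
  -- there.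
  let e (i : Fin (Module.finrank ℝ F)) : Π y : M, Tan F y := fun y ↦ t.symm y (b i)
  have he i : FieldDiffAt (e i) (f x) := by
    have h := FiberBundle.mdifferentiableAt_extend 𝓘(ℝ, F) F (t.symm (f x) (b i))
    have h1 : FiberBundle.extend F (t.symm (f x) (b i)) = e i := by
      funext y
      simp [FiberBundle.extend, e, ← ht, hx]
    rw [h1] at h
    exact h
  let c (i : Fin (Module.finrank ℝ F)) : N → ℝ := fun y ↦ b.coord i (localRep f V x y)
  have hc i : MDifferentiableAt 𝓘(ℝ, E) 𝓘(ℝ, ℝ) (c i) x :=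
    ((b.coord i).toContinuousLinearMap.mdifferentiableAt (x := localRep f V x x)).comp x hr
  -- Differentiability of the partial sums is carried along because `add` requires it.
  have key (s : Finset (Fin (Module.finrank ℝ F))) :
      AlongDiffAt E f (fun y ↦ ∑ i ∈ s, c i y • e i (f y)) x ∧
        P (fun y ↦ ∑ i ∈ s, c i y • e i (f y)) := by
    induction s using Finset.induction_on with
    | empty =>
      have h0 : FieldDiffAt (fun y : M ↦ (0 : Tan F y)) (f x) :=
        Bundle.mdifferentiable_zeroSection ℝ (TangentSpace 𝓘(ℝ, F)) (f x)
      simpa using And.intro (AlongDiffAt.restrict hf h0) (restrict _ h0)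
    | insert a s ha ih =>
      have h1 := AlongDiffAt.restrict hf (he a)
      simp only [Finset.sum_insert ha]
      exact ⟨(h1.smul (hc a)).add ih.1,
        add _ _ (h1.smul (hc a)) ih.1 (smul _ _ (hc a) h1 (restrict _ (he a))) ih.2⟩
  refine congr _ _ ?_ (key Finset.univ).2
  filter_upwards [eventually_mem_baseSet hf] with y hy
  have h1 : t.symmL ℝ (f y) (localRep f V x y) = V y := by
    rw [t.symmL_apply hy]
    exact t.symm_proj_apply (⟨f y, V y⟩ : TangentBundle 𝓘(ℝ, F) M) hy
  rw [← h1, ← b.sum_repr (localRep f V x y), map_sum]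
  refine Finset.sum_congr rfl fun i _ ↦ ?_
  rw [map_smul, t.symmL_apply hy]
  rfl

theorem AlongDiffAt.endo (J : EndomorphismField F M) (hV : AlongDiffAt E f V x) :
    AlongDiffAt E f (fun y ↦ J.endo (f y) (V y)) x := by
  have hf := (alongDiffAt_iff.1 hV).1
  have hJ := ((J.contMDiff (f x)).mdifferentiableAt (by simp)).comp x hf
  exact MDifferentiableAt.clm_bundle_apply (E₁ := (TangentSpace 𝓘(ℝ, F) : M → Type _))
    (E₂ := (TangentSpace 𝓘(ℝ, F) : M → Type _)) (b := f)
    (ϕ := fun y ↦ J.endo (f y)) (v := V) hJ hV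

theorem AlongDiffAt.form (g : SemiRiemannianMetric F M) (hV : AlongDiffAt E f V x)
    (hV' : AlongDiffAt E f V' x) :
    MDifferentiableAt 𝓘(ℝ, E) 𝓘(ℝ, ℝ) (fun y ↦ g.form (f y) (V y) (V' y)) x := by
  have hf := (alongDiffAt_iff.1 hV).1
  have hg := ((g.contMDiff (f x)).mdifferentiableAt (by simp)).comp x hf
  have h := MDifferentiableAt.clm_bundle_apply₂ (E₁ := (TangentSpace 𝓘(ℝ, F) : M → Type _))
    (E₂ := (TangentSpace 𝓘(ℝ, F) : M → Type _)) (E₃ := Bundle.Trivial M ℝ) (F₃ := ℝ) (b := f)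
    (ψ := fun y ↦ g.form (f y)) (v := V) (w := V') hg hV hV'
  exact ((mdifferentiableAt_totalSpace (IB := 𝓘(ℝ, F)) (F := ℝ) _).1 h).2

/-- The induced connection on `f^*TM` makes a parallel `J` parallel. -/
theorem covAlong_endo [FiniteDimensional ℝ F] {cov : Connection F M} {J : EndomorphismField F M}
    (hJ : IsParallel cov J) (hV : AlongDiffAt E f V x) (w : Tan E x) :
    covAlong cov f (fun y ↦ J.endo (f y) (V y)) x w = J.endo (f x) (covAlong cov f V x w) := by
  have hf := (alongDiffAt_iff.1 hV).1
  refine hV.induction (P := fun V ↦ covAlong cov f (fun y ↦ J.endo (f y) (V y)) x w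
    = J.endo (f x) (covAlong cov f V x w)) (fun X hX ↦ ?_) (fun V V' hV hV' h h' ↦ ?_)
    (fun c V hc hV h ↦ ?_) (fun V V' h hV ↦ ?_)
  · have hJX : FieldDiffAt (fun y ↦ J.endo y (X y)) (f x) :=
      AlongDiffAt.endo (E := F) (f := id) J hX
    rw [covAlong_comp cov f x hf X hX, ← hJ X (f x) hX,
      ← covAlong_comp cov f x hf (fun y ↦ J.endo y (X y)) hJX]
  · simp only [map_add]
    rw [covAlong_add cov (hV.endo J) (hV'.endo J), covAlong_add cov hV hV', h, h', map_add]
  · simp only [map_smul]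
    rw [covAlong_smul cov (hV.endo J) hc, covAlong_smul cov hV hc, h]
    simp
  · rw [← covAlong_congr cov h, ← hV]
    refine congrArg (fun T : Tan E x →L[ℝ] Tan F (f x) ↦ T w) (covAlong_congr cov ?_)
    filter_upwards [h] with y hy
    rw [hy]

/-- The induced connection on `f^*TM` is metric. -/
theorem mvfderiv_form [FiniteDimensional ℝ F] {g : SemiRiemannianMetric F M} {cov : Connection F M}
    (hcov : IsLeviCivita g cov) (hV : AlongDiffAt E f V x) (hV' : AlongDiffAt E f V' x)
    (w : Tan E x) :
    mvfderiv 𝓘(ℝ, E) (fun y ↦ g.form (f y) (V y) (V' y)) x w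
      = g.form (f x) (covAlong cov f V x w) (V' x)
        + g.form (f x) (V x) (covAlong cov f V' x w) := by
  have hf := (alongDiffAt_iff.1 hV).1
  have hswap (V V' : Π y : N, Tan F (f y)) :
      (fun y ↦ g.form (f y) (V y) (V' y)) = fun y ↦ g.form (f y) (V' y) (V y) :=
    funext fun y ↦ g.symm _ _ _
  let Q (V V' : Π y : N, Tan F (f y)) : Prop :=
    mvfderiv 𝓘(ℝ, E) (fun y ↦ g.form (f y) (V y) (V' y)) x w
      = g.form (f x) (covAlong cov f V x w) (V' x)
        + g.form (f x) (V x) (covAlong cov f V' x w)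
  have hsymm {V V' : Π y : N, Tan F (f y)} (h : Q V V') : Q V' V := by
    simp only [Q] at h ⊢
    rw [hswap, h, g.symm _ (V x), g.symm _ (V' x), add_comm]
  -- Both sides obey the same Leibniz rule in the first slot, so that slot may be taken to be a
  -- restriction. By symmetry this applies to each slot in turn, which leaves two ambient fields,
  -- where metricity of `cov` and the chain rule finish.
  have step {V' : Π y : N, Tan F (f y)} (hV' : AlongDiffAt E f V' x)
      (hr : ∀ X : Π y : M, Tan F y, FieldDiffAt X (f x) → Q (fun y ↦ X (f y)) V')
      {V : Π y : N, Tan F (f y)} (hV : AlongDiffAt E f V x) : Q V V' := by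
    refine hV.induction (P := fun V ↦ Q V V') hr (fun V₁ V₂ h₁ h₂ q₁ q₂ ↦ ?_)
      (fun c V hc hV q ↦ ?_) (fun V₁ V₂ h q ↦ ?_)
    · have h := mvfderiv_add (h₁.form g hV') (h₂.form g hV')
      simp only [Q] at q₁ q₂ ⊢
      rw [covAlong_add cov h₁ h₂]
      simp only [map_add, add_apply]
      refine (congrArg (fun T ↦ T w) h).trans ?_
      rw [add_apply, q₁, q₂]
      ring
    · have h := mvfderiv_smul hc (hV.form g hV')
      simp only [Q] at q ⊢
      rw [covAlong_smul cov hV hc]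
      simp only [map_add, map_smul, add_apply, smul_apply]
      refine (congrArg (fun T ↦ T w) h).trans ?_
      simp only [add_apply, smul_apply, q, ContinuousLinearMap.smulRight_apply, smul_eq_mul]
      ring
    · simp only [Q] at q ⊢
      rw [← covAlong_congr cov h, ← h.self_of_nhds, ← q]
      refine congrArg (fun T : Tan E x →L[ℝ] ℝ ↦ T w) (mvfderiv_congr ?_)
      filter_upwards [h] with y hy
      rw [hy]
  refine step hV' (fun X hX ↦ hsymm (step (.restrict hf hX) (fun Y hY ↦ ?_) hV')) hV
  have hm := hcov.metric Y X (f x) hY hX (diff E F f x w)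
  simp only [Q]
  rw [covAlong_comp cov f x hf X hX, covAlong_comp cov f x hf Y hY, ← hm]
  exact mvfderiv_comp_apply x (AlongDiffAt.form (E := F) (f := id) g hY hX) hf w

end AlongCalculus

end LightlikeGeometry

namespace LightlikeGeometry

/-! ### The Lie bracket as a commutator of derivations, in a chart. -/

section Bracket

variable {E : Type*} [NormedAddCommGroup E] [NormedSpace ℝ E]
  {N : Type*} [TopologicalSpace N] [ChartedSpace E N]

theorem contDiffAt_comp_extChartAt_symm {G : Type*} [NormedAddCommGroup G]
    [NormedSpace ℝ G] {h : N → G} {x : N}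
    (hh : ContMDiffAt 𝓘(ℝ, E) 𝓘(ℝ, G) ∞ h x) :
    ContDiffAt ℝ ∞ (h ∘ (extChartAt 𝓘(ℝ, E) x).symm) (extChartAt 𝓘(ℝ, E) x x) := by
  have h2 := (contMDiffAt_iff.1 hh).2
  rw [extChartAt_model_space_eq_id] at h2
  rw [← contDiffWithinAt_univ]
  simpa using h2

theorem eventuallyEq_comp_extChartAt {G : Type*} (h : N → G) {x y : N}
    (hy : y ∈ (extChartAt 𝓘(ℝ, E) x).source) :
    h =ᶠ[𝓝 y] (h ∘ (extChartAt 𝓘(ℝ, E) x).symm) ∘ extChartAt 𝓘(ℝ, E) x := by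
  filter_upwards [(isOpen_extChartAt_source (I := 𝓘(ℝ, E)) x).mem_nhds hy] with z hz
  simp only [Function.comp_apply, (extChartAt 𝓘(ℝ, E) x).left_inv hz]

variable [IsManifold 𝓘(ℝ, E) ∞ N] {G : Type*} [NormedAddCommGroup G] [NormedSpace ℝ G]

/-- The vector field `U` in the chart at `x`. -/
def chartRep (U : Π y : N, Tan E y) (x : N) : E → E :=
  VectorField.mpullbackWithin 𝓘(ℝ, E) 𝓘(ℝ, E) (extChartAt 𝓘(ℝ, E) x).symm U
    (Set.range 𝓘(ℝ, E))

theorem chartRep_extChartAt (U : Π y : N, Tan E y) {x y : N}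
    (hy : y ∈ (extChartAt 𝓘(ℝ, E) x).source) :
    chartRep U x (extChartAt 𝓘(ℝ, E) x y)
      = mfderiv 𝓘(ℝ, E) 𝓘(ℝ, E) (extChartAt 𝓘(ℝ, E) x) y (U y) := by
  have : IsManifold 𝓘(ℝ, E) 1 N := IsManifold.of_le (n := ∞) (by simp)
  have hl := (extChartAt 𝓘(ℝ, E) x).left_inv hy
  have hi := isInvertible_mfderivWithin_extChartAt_symm
    ((extChartAt 𝓘(ℝ, E) x).map_source hy)
  have hc := mfderivWithin_extChartAt_symm_comp_mfderiv_extChartAt' (I := 𝓘(ℝ, E)) hy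
  refine hi.inverse_apply_eq.2 ?_
  have h := congrArg (fun T : E →L[ℝ] E ↦ T (U y)) hc
  refine Eq.trans ?_ h.symm
  change (U ((extChartAt 𝓘(ℝ, E) x).symm (extChartAt 𝓘(ℝ, E) x y)) : E) = (U y : E)
  rw [hl]

/-- The tangent space at `x` is identified with `E` through the chart at `x` itself, so the
derivative of that chart at `x` is the identity. -/
theorem chartRep_self (U : Π y : N, Tan E y) (x : N) :
    chartRep U x (extChartAt 𝓘(ℝ, E) x x) = U x := by
  have : IsManifold 𝓘(ℝ, E) 1 N := IsManifold.of_le (n := ∞) (by simp)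
  rw [chartRep_extChartAt U (mem_extChartAt_source x), mfderiv_extChartAt_self]
  rfl

theorem differentiableAt_chartRep [CompleteSpace E] {U : Π y : N, Tan E y} {x : N}
    (hU : FieldDiffAt U x) : DifferentiableAt ℝ (chartRep U x) (extChartAt 𝓘(ℝ, E) x x) := by
  have : IsManifold 𝓘(ℝ, E) 2 N := IsManifold.of_le (n := ∞) (by norm_cast)
  have h := (MDifferentiableAt.mdifferentiableWithinAt (s := Set.univ)
    hU).differentiableWithinAt_mpullbackWithin_vectorField
  rw [← differentiableWithinAt_univ]
  simpa [chartRep] using h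

theorem mlieBracket_eq_lieBracket_chartRep (U W : Π y : N, Tan E y) (x : N) :
    VectorField.mlieBracket 𝓘(ℝ, E) U W x
      = VectorField.lieBracket ℝ (chartRep U x) (chartRep W x) (extChartAt 𝓘(ℝ, E) x x) := by
  have : IsManifold 𝓘(ℝ, E) 1 N := IsManifold.of_le (n := ∞) (by simp)
  have hs : (extChartAt 𝓘(ℝ, E) x).symm ⁻¹' Set.univ ∩ Set.range 𝓘(ℝ, E) = Set.univ := by simp
  rw [← VectorField.mlieBracketWithin_univ, VectorField.mlieBracketWithin_apply,
    mfderiv_extChartAt_self, hs]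
  erw [VectorField.lieBracketWithin_univ]
  exact congrArg (fun T : E →L[ℝ] E ↦ T _) ContinuousLinearMap.inverse_id

theorem mvfderiv_comp_extChartAt {k : E → G} {x y : N}
    (hy : y ∈ (extChartAt 𝓘(ℝ, E) x).source)
    (hk : DifferentiableAt ℝ k (extChartAt 𝓘(ℝ, E) x y)) (w : Tan E y) :
    mvfderiv 𝓘(ℝ, E) (k ∘ extChartAt 𝓘(ℝ, E) x) y w
      = fderiv ℝ k (extChartAt 𝓘(ℝ, E) x y)
        (mfderiv 𝓘(ℝ, E) 𝓘(ℝ, E) (extChartAt 𝓘(ℝ, E) x) y w) := by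
  have : IsManifold 𝓘(ℝ, E) 1 N := IsManifold.of_le (n := ∞) (by simp)
  have hψ : MDifferentiableAt 𝓘(ℝ, E) 𝓘(ℝ, E) (extChartAt 𝓘(ℝ, E) x) y :=
    mdifferentiableAt_extChartAt (by simpa using hy)
  refine (mfderiv_comp_apply y hk.mdifferentiableAt hψ w).trans ?_
  rw [mfderiv_eq_fderiv]
  rfl

theorem mvfderiv_comp_extChartAt_self {k : E → G} {x : N}
    (hk : DifferentiableAt ℝ k (extChartAt 𝓘(ℝ, E) x x)) (w : Tan E x) :
    mvfderiv 𝓘(ℝ, E) (k ∘ extChartAt 𝓘(ℝ, E) x) x w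
      = fderiv ℝ k (extChartAt 𝓘(ℝ, E) x x) w := by
  have : IsManifold 𝓘(ℝ, E) 1 N := IsManifold.of_le (n := ∞) (by simp)
  rw [mvfderiv_comp_extChartAt (mem_extChartAt_source x) hk, mfderiv_extChartAt_self]
  rfl

/-- Equality on a whole neighbourhood is what allows a second differentiation at `x`. -/
theorem mvfderiv_apply_eventuallyEq {h : N → G} {x : N}
    (hh : ContMDiffAt 𝓘(ℝ, E) 𝓘(ℝ, G) ∞ h x) (U : Π y : N, Tan E y) :
    (fun y ↦ mvfderiv 𝓘(ℝ, E) h y (U y)) =ᶠ[𝓝 x]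
      (fun u ↦ fderiv ℝ (h ∘ (extChartAt 𝓘(ℝ, E) x).symm) u (chartRep U x u)) ∘
        extChartAt 𝓘(ℝ, E) x := by
  have hd : ∀ᶠ u in 𝓝 (extChartAt 𝓘(ℝ, E) x x),
      DifferentiableAt ℝ (h ∘ (extChartAt 𝓘(ℝ, E) x).symm) u := by
    filter_upwards [((contDiffAt_comp_extChartAt_symm hh).of_le
      (m := 1) (by simp)).eventually (by simp)] with u hu
    exact hu.differentiableAt (by simp)
  filter_upwards [extChartAt_source_mem_nhds (I := 𝓘(ℝ, E)) x,
    (continuousAt_extChartAt (I := 𝓘(ℝ, E)) x).eventually hd] with y hy hdy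
  rw [Function.comp_apply, chartRep_extChartAt U hy,
    mvfderiv_congr (eventuallyEq_comp_extChartAt h hy)]
  exact mvfderiv_comp_extChartAt hy hdy (U y)

/-- The Lie bracket of vector fields, as a commutator of derivations. -/
theorem mvfderiv_mlieBracket [CompleteSpace E] {h : N → G} {x : N}
    (hh : ContMDiffAt 𝓘(ℝ, E) 𝓘(ℝ, G) ∞ h x) {U W : Π y : N, Tan E y}
    (hU : FieldDiffAt U x) (hW : FieldDiffAt W x) :
    mvfderiv 𝓘(ℝ, E) h x (VectorField.mlieBracket 𝓘(ℝ, E) U W x)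
      = mvfderiv 𝓘(ℝ, E) (fun y ↦ mvfderiv 𝓘(ℝ, E) h y (W y)) x (U x)
        - mvfderiv 𝓘(ℝ, E) (fun y ↦ mvfderiv 𝓘(ℝ, E) h y (U y)) x (W x) := by
  let k : E → G := h ∘ (extChartAt 𝓘(ℝ, E) x).symm
  let u₀ : E := extChartAt 𝓘(ℝ, E) x x
  have hkd : ContDiffAt ℝ ∞ k u₀ := contDiffAt_comp_extChartAt_symm hh
  have hk' : DifferentiableAt ℝ (fderiv ℝ k) u₀ :=
    (hkd.fderiv_right (m := 1) (by norm_cast)).differentiableAt (by simp)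
  -- Product rule in the chart: a Hessian term plus the derivative of `k` applied to the derivative
  -- of the field. The Hessian terms cancel by symmetry, and the rest is the flat Lie bracket.
  have second {V : Π y : N, Tan E y} (hV : FieldDiffAt V x) (w : Tan E x) :
      mvfderiv 𝓘(ℝ, E) (fun y ↦ mvfderiv 𝓘(ℝ, E) h y (V y)) x w
        = fderiv ℝ (fderiv ℝ k) u₀ w (V x) + fderiv ℝ k u₀ (fderiv ℝ (chartRep V x) u₀ w) := by
    have hd := differentiableAt_chartRep hV
    rw [mvfderiv_congr (mvfderiv_apply_eventuallyEq hh V)]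
    refine (mvfderiv_comp_extChartAt_self (hk'.clm_apply hd) w).trans ?_
    have hl := fderiv_clm_apply hk' hd
    refine (congrArg (fun T : E →L[ℝ] G ↦ T w) hl).trans ?_
    rw [chartRep_self, add_comm]
    rfl
  have first (v : Tan E x) : mvfderiv 𝓘(ℝ, E) h x v = fderiv ℝ k u₀ v := by
    rw [mvfderiv_congr (eventuallyEq_comp_extChartAt h
      (mem_extChartAt_source (I := 𝓘(ℝ, E)) x))]
    exact mvfderiv_comp_extChartAt_self (hkd.differentiableAt (by simp)) v
  have hs : fderiv ℝ (fderiv ℝ k) u₀ (U x) (W x) = fderiv ℝ (fderiv ℝ k) u₀ (W x) (U x) :=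
    hkd.isSymmSndFDerivAt (by simp; norm_cast) _ _
  rw [second hU, second hW, first, mlieBracket_eq_lieBracket_chartRep, VectorField.lieBracket,
    chartRep_self, chartRep_self, map_sub, hs]
  abel

end Bracket

/-! ### Torsion-freeness of the induced connection. -/

section Torsion

variable {E : Type*} [NormedAddCommGroup E] [NormedSpace ℝ E] [FiniteDimensional ℝ E]
  {N : Type*} [TopologicalSpace N] [ChartedSpace E N] [IsManifold 𝓘(ℝ, E) ∞ N]
  {F : Type*} [NormedAddCommGroup F] [NormedSpace ℝ F]
  {M : Type*} [TopologicalSpace M] [ChartedSpace F M] [IsManifold 𝓘(ℝ, F) ∞ M]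

/-- Trivializations of the tangent bundle are derivatives of charts; this turns the components of a
pushed-forward field into a derivative of the chart composed with `f`. -/
theorem trivializationAt_snd_eq {m₀ m : M} (hm : m ∈ (chartAt F m₀).source) (v : Tan F m) :
    (trivializationAt F (TangentSpace 𝓘(ℝ, F)) m₀ (⟨m, v⟩ : TangentBundle 𝓘(ℝ, F) M)).2
      = mvfderiv 𝓘(ℝ, F) (extChartAt 𝓘(ℝ, F) m₀) m v := by
  have : IsManifold 𝓘(ℝ, F) 1 M := IsManifold.of_le (n := ∞) (by simp)
  have h := TangentBundle.continuousLinearMapAt_trivializationAt (I := 𝓘(ℝ, F)) hm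
  have h1 := congrArg (fun T : F →L[ℝ] F ↦ T v) h
  refine Eq.trans ?_ h1
  have hb : m ∈ (trivializationAt F (TangentSpace 𝓘(ℝ, F)) m₀).baseSet := by simpa using hm
  exact (Bundle.Trivialization.continuousLinearMapAt_apply_of_mem ℝ _ hb v).symm

variable [FiniteDimensional ℝ F]

/-- The extensions have constant components in the chart at `m`, so the commutator formula applied
to the chart map has zero right-hand side, while the derivative of the chart at `m` is the identity.
-/
theorem mlieBracket_extend {m : M} (v w : Tan F m) :
    VectorField.mlieBracket 𝓘(ℝ, F) (FiberBundle.extend F v : Π y : M, Tan F y)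
      (FiberBundle.extend F w) m = 0 := by
  have : IsManifold 𝓘(ℝ, F) 1 M := IsManifold.of_le (n := ∞) (by simp)
  have hd (u : Tan F m) : FieldDiffAt (FiberBundle.extend F u) m :=
    FiberBundle.mdifferentiableAt_extend 𝓘(ℝ, F) F u
  have hφ : ContMDiffAt 𝓘(ℝ, F) 𝓘(ℝ, F) ∞ (extChartAt 𝓘(ℝ, F) m) m := contMDiffAt_extChartAt
  have hc (u : Tan F m) : mvfderiv 𝓘(ℝ, F) (fun y ↦ mvfderiv 𝓘(ℝ, F) (extChartAt 𝓘(ℝ, F) m) y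
      (FiberBundle.extend F u y)) m = 0 := by
    rw [mvfderiv_congr (b := fun _ ↦ (trivializationAt F (TangentSpace 𝓘(ℝ, F)) m
      (⟨m, u⟩ : TangentBundle 𝓘(ℝ, F) M)).2), mvfderiv_const]
    filter_upwards [(chartAt F m).open_source.mem_nhds (mem_chart_source F m)] with y hy
    have hb : y ∈ (trivializationAt F (TangentSpace 𝓘(ℝ, F)) m).baseSet := by simpa using hy
    rw [← trivializationAt_snd_eq hy]
    have h := Bundle.Trivialization.apply_mk_symm _ hb
      (trivializationAt F (TangentSpace 𝓘(ℝ, F)) m (⟨m, u⟩ : TangentBundle 𝓘(ℝ, F) M)).2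
    exact (congrArg Prod.snd h :)
  have h := mvfderiv_mlieBracket hφ (hd v) (hd w)
  rw [hc, hc, zero_apply, zero_apply, sub_zero, mvfderiv, mfderiv_extChartAt_self] at h
  exact h

/-- The induced connection on `f^*TM` is torsion-free. -/
theorem covAlong_sub_covAlong {g : SemiRiemannianMetric F M} {cov : Connection F M}
    (hcov : IsLeviCivita g cov) {f : N → M} (hf : ContMDiff 𝓘(ℝ, E) 𝓘(ℝ, F) ∞ f)
    {U W : Π y : N, Tan E y} {x : N} (hU : FieldDiffAt U x) (hW : FieldDiffAt W x) :
    covAlong cov f (fun y ↦ diff E F f y (U y)) x (W x)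
      - covAlong cov f (fun y ↦ diff E F f y (W y)) x (U x)
      = diff E F f x (VectorField.mlieBracket 𝓘(ℝ, E) W U x) := by
  have : IsManifold 𝓘(ℝ, F) 1 M := IsManifold.of_le (n := ∞) (by simp)
  have hd (u : Tan F (f x)) : FieldDiffAt (FiberBundle.extend F u) (f x) :=
    FiberBundle.mdifferentiableAt_extend 𝓘(ℝ, F) F u
  let φ : M → F := extChartAt 𝓘(ℝ, F) (f x)
  have hφf : ContMDiffAt 𝓘(ℝ, E) 𝓘(ℝ, F) ∞ (φ ∘ f) x := contMDiffAt_extChartAt.comp x (hf x)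
  have hfd (y : N) : MDifferentiableAt 𝓘(ℝ, E) 𝓘(ℝ, F) f y :=
    (hf y).mdifferentiableAt (by simp)
  have hchain {y : N} (hy : f y ∈ (chartAt F (f x)).source) (v : Tan E y) :
      (trivializationAt F (TangentSpace 𝓘(ℝ, F)) (f x)
        (⟨f y, diff E F f y v⟩ : TangentBundle 𝓘(ℝ, F) M)).2
        = mvfderiv 𝓘(ℝ, E) (φ ∘ f) y v := by
    rw [trivializationAt_snd_eq hy]
    exact (mfderiv_comp_apply y (mdifferentiableAt_extChartAt hy) (hfd y) v).symm
  have hrep (V : Π y : N, Tan E y) : localRep f (fun y ↦ diff E F f y (V y)) x =ᶠ[𝓝 x]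
      fun y ↦ mvfderiv 𝓘(ℝ, E) (φ ∘ f) y (V y) := by
    filter_upwards [(hfd x).continuousAt.preimage_mem_nhds
      ((chartAt F (f x)).open_source.mem_nhds (mem_chart_source F (f x)))] with y hy
    exact hchain hy (V y)
  -- Since extensions commute at `f x`, this is the symmetry of the Christoffel symbols. The
  -- connection terms therefore cancel, and the commutator formula for `φ ∘ f` handles the
  -- derivatives of the components.
  have htor := hcov.torsion_free _ _ (f x) (hd (diff E F f x (W x))) (hd (diff E F f x (U x)))
  rw [mlieBracket_extend, FiberBundle.extend_apply_self, FiberBundle.extend_apply_self] at htor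
  have hbr := mvfderiv_mlieBracket hφf hW hU
  rw [← hchain (mem_chart_source F (f x))] at hbr
  rw [covAlong, covAlong, mvfderiv_congr (hrep U), mvfderiv_congr (hrep W)]
  simp only [add_apply, ContinuousLinearMap.comp_apply]
  rw [add_sub_add_comm, htor, add_zero, ← map_sub, ← hbr]
  exact symmL_localRep_self
    (V := fun y ↦ diff E F f y (VectorField.mlieBracket 𝓘(ℝ, E) W U y))

end Torsion

end LightlikeGeometry

namespace LightlikeGeometry

/-! ### Global sections with a prescribed value. -/

section Sections

variable {E : Type*} [NormedAddCommGroup E] [NormedSpace ℝ E]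
  {N : Type*} [TopologicalSpace N] [ChartedSpace E N] [IsManifold 𝓘(ℝ, E) ∞ N]

theorem IsSection.fieldDiffAt {D : Π x : N, Submodule ℝ (Tan E x)} {W : Π x : N, Tan E x}
    (hW : IsSection D W) (x : N) : FieldDiffAt W x :=
  (hW.contMDiff x).mdifferentiableAt (by simp)

/-- Every vector of a smooth distribution extends to a global smooth section. -/
theorem IsSmoothSubbundle.exists_isSection [FiniteDimensional ℝ E] [T2Space N]
    {D : Π x : N, Submodule ℝ (Tan E x)}
    (hD : IsSmoothSubbundle (E := E) (F := E) (id : N → N) D) {x : N} {z : Tan E x}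
    (hz : z ∈ D x) : ∃ Z : Π y : N, Tan E y, IsSection D Z ∧ Z x = z := by
  obtain ⟨U, hU, k, s, hs, hD⟩ := hD x
  obtain ⟨V, hVU, hVo, hxV⟩ := mem_nhds_iff.1 hU
  obtain ⟨b, hb, -⟩ := (SmoothBumpFunction.nhds_basis_support (I := 𝓘(ℝ, E))
    (hVo.mem_nhds hxV)).mem_iff.1 (hVo.mem_nhds hxV)
  have hz' : z ∈ Submodule.span ℝ (Set.range fun i ↦ s i x) := by
    rw [(hD x (hVU hxV)).2]
    exact hz
  obtain ⟨c, hc⟩ := (Submodule.mem_span_range_iff_exists_fun ℝ).1 hz'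
  -- Constant coefficients in the local frame. The cutoff `b` equals 1 at `x` and has its closed
  -- support in `V`, so `b • σ` is smooth everywhere.
  let σ : Π y : N, Tan E y := fun y ↦ ∑ i, c i • s i y
  have hσ : ContMDiffOn 𝓘(ℝ, E) 𝓘(ℝ, E).tangent ∞
      (fun y ↦ (⟨y, σ y⟩ : TangentBundle 𝓘(ℝ, E) N)) V :=
    ContMDiffOn.sum_section fun i _ ↦
      ContMDiffOn.const_smul_section ((hs i).mono hVU)
  refine ⟨fun y ↦ b y • σ y, ⟨?_, fun y ↦ ?_⟩, ?_⟩
  · exact ContMDiffOn.smul_section_of_tsupport b.contMDiff.contMDiffOn hVo hb hσ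
  · by_cases hy : y ∈ V
    · refine (D y).smul_mem _ ((D y).sum_mem fun i _ ↦ (D y).smul_mem _ ?_)
      have h := (hD y (hVU hy)).2
      rw [← h]
      exact Submodule.subset_span ⟨i, rfl⟩
    · have : b y = 0 := image_eq_zero_of_notMem_tsupport fun h ↦ hy (hb h)
      simp [this]
  · simp only [b.eq_one, one_smul]
    exact hc

end Sections

namespace LightlikeSubmanifold

variable {E : Type*} [NormedAddCommGroup E] [NormedSpace ℝ E]
  {N : Type*} [TopologicalSpace N] [ChartedSpace E N] [IsManifold 𝓘(ℝ, E) ∞ N]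
  {F : Type*} [NormedAddCommGroup F] [NormedSpace ℝ F]
  {M : Type*} [TopologicalSpace M] [ChartedSpace F M] [IsManifold 𝓘(ℝ, F) ∞ M]
  {g : SemiRiemannianMetric F M} (L : LightlikeSubmanifold E N g)

/-! ### Linear algebra of the decompositions in a single fibre. -/

section Pointwise

variable {L} {x : N}

theorem form_screenTr_df {v : Tan F (L.f x)} (hv : v ∈ L.screenTr x) (w : Tan E x) :
    g.form (L.f x) v (L.df x w) = 0 := by
  have h : v ∈ normal E g L.f x := by
    rw [← L.sup_screenTr x]
    exact Submodule.mem_sup_right hv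
  exact h w

theorem form_df_screenTr {v : Tan F (L.f x)} (hv : v ∈ L.screenTr x) (w : Tan E x) :
    g.form (L.f x) (L.df x w) v = 0 := by
  rw [g.symm, form_screenTr_df hv]

theorem form_rad {u : Tan E x} (hu : u ∈ L.rad x) (w : Tan E x) :
    g.form (L.f x) (L.df x u) (L.df x w) = 0 :=
  hu w

/-- The metric sees only the tangential component of a vector against the screen distribution. -/
theorem form_tanPart (v : Tan F (L.f x)) {z : Tan E x} (hz : z ∈ L.screen x) :
    g.form (L.f x) (L.df x (L.tanPart x v)) (L.df x z) = g.form (L.f x) v (L.df x z) := by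
  have h1 : L.df x (L.tanPart x v)
      = Submodule.projection _ _ (L.isCompl_tr x) v := by
    have h := LinearEquiv.ofInjective_symm_apply (f := L.df x) (h := L.injective_diff x)
      (Submodule.projectionOnto _ _ (L.isCompl_tr x) v)
    exact h
  have h2 : v - L.df x (L.tanPart x v) ∈ L.ltr x ⊔ L.screenTr x := by
    rw [h1, ← Submodule.projection_eq_self_sub_projection (L.isCompl_tr x)]
    exact Submodule.projection_apply_mem _ _
  obtain ⟨a, ha, b, hb, hab⟩ := Submodule.mem_sup.1 h2
  have h3 : v = L.df x (L.tanPart x v) + (a + b) := by rw [hab]; abel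
  conv_rhs => rw [h3]
  have ha0 : g.form (L.f x) a (L.df x z) = 0 := L.ltr_screen x a ha z hz
  simp only [map_add, add_apply, ha0, form_screenTr_df hb, add_zero]

/-- Tangent vectors are orthogonal to the radical summand anyway, so orthogonality to TN need only
be tested on the screen. -/
theorem mem_rad_iff (w : Tan E x) :
    w ∈ L.rad x ↔ ∀ z ∈ L.screen x, g.form (L.f x) (L.df x w) (L.df x z) = 0 := by
  refine ⟨fun h z _ ↦ form_rad h z, fun h v ↦ ?_⟩
  obtain ⟨u, hu, z, hz, rfl⟩ := Submodule.mem_sup.1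
    ((L.isCompl_screen x).sup_eq_top ▸ Submodule.mem_top : v ∈ L.rad x ⊔ L.screen x)
  have h1 : g.form (L.f x) (L.df x w) (L.df x u) = 0 := by rw [g.symm]; exact form_rad hu w
  have h2 : g.form (L.f x) (L.df x w) (L.df x (u + z)) = 0 := by
    rw [map_add, map_add, h1, h z hz, add_zero]
  exact h2

theorem tanPart_mem_rad_iff (v : Tan F (L.f x)) :
    L.tanPart x v ∈ L.rad x ↔ ∀ z ∈ L.screen x, g.form (L.f x) v (L.df x z) = 0 := by
  rw [mem_rad_iff]
  exact forall₂_congr fun z hz ↦ by rw [form_tanPart v hz]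

theorem screenPart_eq_zero_iff (w : Tan E x) : L.screenPart x w = 0 ↔ w ∈ L.rad x :=
  Submodule.projection_apply_eq_zero_iff _

theorem form_screenPart (w z : Tan E x) :
    g.form (L.f x) (L.df x (L.screenPart x w)) (L.df x z)
      = g.form (L.f x) (L.df x w) (L.df x z) := by
  have h : w - L.screenPart x w ∈ L.rad x := by
    rw [screenPart, ← Submodule.projection_eq_self_sub_projection (L.isCompl_screen x).symm]
    exact Submodule.projection_apply_mem _ _
  have h1 := form_rad h z
  rw [map_sub, map_sub, sub_apply] at h1
  linarith

/-- The discarded components lie in TN and ltr(TN), both orthogonal to S(TN^⊥). -/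
theorem form_screenTrPart (v : Tan F (L.f x)) {u : Tan F (L.f x)} (hu : u ∈ L.screenTr x) :
    g.form (L.f x) (L.screenTrPart x v) u = g.form (L.f x) v u := by
  have h : v - L.screenTrPart x v ∈ LinearMap.range (L.df x) ⊔ L.ltr x := by
    rw [screenTrPart, ← Submodule.projection_eq_self_sub_projection (L.isCompl_screenTr x)]
    exact Submodule.projection_apply_mem _ _
  obtain ⟨_, ⟨a, rfl⟩, b, hb, hab⟩ := Submodule.mem_sup.1 h
  have h3 : v = L.screenTrPart x v + (L.df x a + b) := by rw [hab]; abel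
  conv_rhs => rw [h3]
  simp only [map_add, add_apply, form_df_screenTr hu, L.ltr_screenTr x b u hb hu, add_zero]

end Pointwise

/-! ### J on the screen and the radical; the induced operators paired with the screen. -/

variable {L} {J : EndomorphismField F M}

theorem IsRadicalScreenTransversal.exists_endo_df (hL : L.IsRadicalScreenTransversal J) {x : N}
    {z : Tan E x} (hz : z ∈ L.screen x) :
    ∃ z' ∈ L.screen x, J.endo (L.f x) (L.df x z) = L.df x z' := by
  have h : J.endo (L.f x) (L.df x z) ∈ (L.screen x).map (L.df x) := by
    rw [← hL.screen_eq x]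
    exact ⟨_, ⟨z, hz, rfl⟩, rfl⟩
  obtain ⟨z', hz', h⟩ := h
  exact ⟨z', hz', h.symm⟩

theorem IsRadicalScreenTransversal.exists_df_eq_endo (hL : L.IsRadicalScreenTransversal J) {x : N}
    {z : Tan E x} (hz : z ∈ L.screen x) :
    ∃ z' ∈ L.screen x, L.df x z = J.endo (L.f x) (L.df x z') := by
  have h : L.df x z ∈ ((L.screen x).map (L.df x)).map (J.endo (L.f x)).toLinearMap := by
    rw [hL.screen_eq x]
    exact ⟨z, hz, rfl⟩
  obtain ⟨_, ⟨z', hz', rfl⟩, h⟩ := h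
  exact ⟨z', hz', h.symm⟩

theorem IsRadicalScreenTransversal.endo_mem_screenTr (hL : L.IsRadicalScreenTransversal J) {x : N}
    {u : Tan E x} (hu : u ∈ L.rad x) : J.endo (L.f x) (L.df x u) ∈ L.screenTr x :=
  hL.rad_le x ⟨_, ⟨u, hu, rfl⟩, rfl⟩

theorem alongDiffAt_push {U : Π x : N, Tan E x} {x : N} (hU : FieldDiffAt U x) :
    AlongDiffAt E L.f (L.push U) x := by
  have : IsManifold 𝓘(ℝ, E) 1 N := IsManifold.of_le (n := ∞) (by simp)
  have : IsManifold 𝓘(ℝ, F) 1 M := IsManifold.of_le (n := ∞) (by simp)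
  have ht := L.contMDiff.contMDiff_tangentMap (m := 1) (by norm_cast)
  exact ((ht ⟨x, U x⟩).mdifferentiableAt (by simp)).comp x hU

variable (L) in
/-- The ambient derivatives of radical vector fields in radical directions are orthogonal to the
screen distribution. -/
def RadDerivOrthogonalScreen (cov : Connection F M) : Prop :=
  ∀ W U : Π x : N, Tan E x, IsSection L.rad W → IsSection L.rad U → ∀ x : N, ∀ z ∈ L.screen x,
    g.form (L.f x) (covAlong cov L.f (L.push U) x (W x)) (L.df x z) = 0

variable {cov : Connection F M}

theorem indConn_mem_rad_iff (W U : Π x : N, Tan E x) (x : N) :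
    L.indConn cov W U x ∈ L.rad x ↔ ∀ z ∈ L.screen x,
      g.form (L.f x) (covAlong cov L.f (L.push U) x (W x)) (L.df x z) = 0 :=
  tanPart_mem_rad_iff _

theorem shapeStar_eq_zero_iff (W U : Π x : N, Tan E x) (x : N) :
    L.shapeStar cov U W x = 0 ↔ L.indConn cov W U x ∈ L.rad x := by
  rw [shapeStar, neg_eq_zero, screenPart_eq_zero_iff]

theorem form_shapeStar (W U : Π x : N, Tan E x) {x : N} {z : Tan E x} (hz : z ∈ L.screen x) :
    g.form (L.f x) (L.df x (L.shapeStar cov U W x)) (L.df x z)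
      = -g.form (L.f x) (covAlong cov L.f (L.push U) x (W x)) (L.df x z) := by
  rw [shapeStar, map_neg, map_neg, neg_apply, form_screenPart, indConn, form_tanPart _ hz]

section Main

variable [FiniteDimensional ℝ F]

/-- Involutivity costs nothing: by torsion-freeness the pushed-forward bracket is the difference of
two ambient derivatives, each orthogonal to the screen. -/
theorem radTotallyGeodesicFoliation_iff [FiniteDimensional ℝ E] (hcov : IsLeviCivita g cov) :
    L.RadTotallyGeodesicFoliation cov ↔ L.RadDerivOrthogonalScreen cov := by
  refine ⟨fun h W U hW hU x ↦ (indConn_mem_rad_iff W U x).1 (h.geodesic W U hW hU x),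
    fun h ↦ ⟨fun W U hW hU x ↦ (mem_rad_iff _).2 fun z hz ↦ ?_,
      fun W U hW hU x ↦ (indConn_mem_rad_iff W U x).2 (h W U hW hU x)⟩⟩
  have ht := covAlong_sub_covAlong hcov L.contMDiff (hU.fieldDiffAt x) (hW.fieldDiffAt x)
  have h1 := h W U hW hU x z hz
  have h2 := h U W hU hW x z hz
  have h3 : L.df x (VectorField.mlieBracket 𝓘(ℝ, E) W U x)
      = covAlong cov L.f (L.push U) x (W x) - covAlong cov L.f (L.push W) x (U x) := ht.symm
  rw [h3, map_sub, sub_apply, h1, h2, sub_zero]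

theorem covAlong_endoPush (hparallel : IsParallel cov J) {U : Π x : N, Tan E x} {x : N}
    (hU : FieldDiffAt U x) (w : Tan E x) :
    covAlong cov L.f (L.endoPush J U) x w = J.endo (L.f x) (covAlong cov L.f (L.push U) x w) :=
  covAlong_endo hparallel (alongDiffAt_push hU) w

/-- J leaves the derivative because it is parallel, then passes to `z` because it is self-adjoint.
-/
theorem form_shape {p q : ℕ} (hmetallic : IsMetallic g J p q) (hparallel : IsParallel cov J)
    (W : Π x : N, Tan E x) {U : Π x : N, Tan E x} {x : N} (hU : FieldDiffAt U x)
    {z : Tan E x} (hz : z ∈ L.screen x) :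
    g.form (L.f x) (L.df x (L.shape cov (L.endoPush J U) W x)) (L.df x z)
      = -g.form (L.f x) (covAlong cov L.f (L.push U) x (W x)) (J.endo (L.f x) (L.df x z)) := by
  rw [shape, map_neg, map_neg, neg_apply, form_tanPart _ hz, covAlong_endoPush hparallel hU,
    hmetallic.compatible]

/-- JZ is tangent and JU lies in S(TN^⊥), so g(JZ, JU) vanishes identically. Differentiating moves
the derivative from JZ to JU, and the J in front of U is then shifted onto JZ. -/
theorem form_hs {p q : ℕ} (hcov : IsLeviCivita g cov) (hmetallic : IsMetallic g J p q)
    (hparallel : IsParallel cov J) (hL : L.IsRadicalScreenTransversal J)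
    (W : Π x : N, Tan E x) {U Z : Π x : N, Tan E x} (hU : IsSection L.rad U)
    (hZ : IsSection L.screen Z) (x : N) :
    g.form (L.f x) (L.hs cov W (L.endoPush J Z) x) (L.endoPush J U x)
      = -g.form (L.f x) (covAlong cov L.f (L.push U) x (W x))
        (J.endo (L.f x) (J.endo (L.f x) (L.df x (Z x)))) := by
  have hJU (y : N) : L.endoPush J U y ∈ L.screenTr y := hL.endo_mem_screenTr (hU.mem y)
  have h0 (y : N) : g.form (L.f y) (L.endoPush J Z y) (L.endoPush J U y) = 0 := by
    obtain ⟨z', -, hz'⟩ := hL.exists_endo_df (hZ.mem y)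
    have h : L.endoPush J Z y = L.df y z' := hz'
    rw [h, form_df_screenTr (hJU y)]
  have hm := mvfderiv_form hcov ((alongDiffAt_push (L := L) (hZ.fieldDiffAt x)).endo J)
    ((alongDiffAt_push (L := L) (hU.fieldDiffAt x)).endo J) (W x)
  have h1 : mvfderiv 𝓘(ℝ, E) (fun y ↦ g.form (L.f y) (J.endo (L.f y) (L.push Z y))
      (J.endo (L.f y) (L.push U y))) x = 0 :=
    (mvfderiv_congr (b := fun _ ↦ (0 : ℝ)) (Filter.Eventually.of_forall h0)).trans
      (mvfderiv_const _)
  rw [h1, zero_apply, covAlong_endo hparallel (alongDiffAt_push (hU.fieldDiffAt x)),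
    g.symm _ (J.endo (L.f x) (L.push Z x)), hmetallic.compatible] at hm
  rw [hs, form_screenTrPart _ (hJU x)]
  exact eq_neg_of_add_eq_zero_left hm.symm

end Main

end LightlikeSubmanifold

end LightlikeGeometry

theorem mainTheorem12
    {E : Type*} [NormedAddCommGroup E] [NormedSpace ℝ E] [FiniteDimensional ℝ E]
    {N : Type*} [TopologicalSpace N] [T2Space N] [SecondCountableTopology N]
    [ChartedSpace E N] [IsManifold 𝓘(ℝ, E) ∞ N]
    {F : Type*} [NormedAddCommGroup F] [NormedSpace ℝ F] [FiniteDimensional ℝ F]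
    {M : Type*} [TopologicalSpace M] [T2Space M] [SecondCountableTopology M]
    [ChartedSpace F M] [IsManifold 𝓘(ℝ, F) ∞ M]
    (g : LightlikeGeometry.SemiRiemannianMetric F M)
    (cov : LightlikeGeometry.Connection F M) (hcov : LightlikeGeometry.IsLeviCivita g cov)
    (J : LightlikeGeometry.EndomorphismField F M) (p q : ℕ)
    (hmetallic : LightlikeGeometry.IsMetallic g J p q)
    (hparallel : LightlikeGeometry.IsParallel cov J)
    (L : LightlikeGeometry.LightlikeSubmanifold E N g)
    (hL : L.IsRadicalScreenTransversal J) :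
    L.RadTotallyGeodesicFoliation cov ↔
      (∀ W U : Π x : N, LightlikeGeometry.Tan E x,
        LightlikeGeometry.IsSection L.rad W → LightlikeGeometry.IsSection L.rad U → ∀ x : N,
          L.shape cov (L.endoPush J U) W x ∈ L.rad x ∧ L.shapeStar cov U W x = 0) ∨
      (∀ W U : Π x : N, LightlikeGeometry.Tan E x,
        LightlikeGeometry.IsSection L.rad W → LightlikeGeometry.IsSection L.rad U → ∀ x : N,
          L.shape cov (L.endoPush J U) W x = (p : ℝ) • L.shapeStar cov U W x) ∨
      (∀ W Z : Π x : N, LightlikeGeometry.Tan E x,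
        LightlikeGeometry.IsSection L.rad W → LightlikeGeometry.IsSection L.screen Z → ∀ x : N,
          L.NoComponent x (L.hs cov W (L.endoPush J Z) x) (L.endoRad J x)) := by
  rw [LightlikeGeometry.LightlikeSubmanifold.radTotallyGeodesicFoliation_iff hcov]
  have hsq (x : N) (v : LightlikeGeometry.Tan F (L.f x)) (w : LightlikeGeometry.Tan F (L.f x)) :
      g.form (L.f x) v (J.endo (L.f x) (J.endo (L.f x) w))
        = p * g.form (L.f x) v (J.endo (L.f x) w) + q * g.form (L.f x) v w := by
    rw [hmetallic.sq_eq, map_add, map_smul, map_smul, smul_eq_mul, smul_eq_mul]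
  -- A totally geodesic foliation always satisfies (i): its first half is ω(Jz) = 0 with Jz again in
  -- the screen, its second half is ω = 0.
  refine ⟨fun h ↦ Or.inl fun W U hW hU x ↦ ⟨?_, ?_⟩, ?_⟩
  · refine (LightlikeGeometry.LightlikeSubmanifold.mem_rad_iff _).2 fun z hz ↦ ?_
    obtain ⟨z', hz', he⟩ := hL.exists_endo_df hz
    rw [LightlikeGeometry.LightlikeSubmanifold.form_shape hmetallic hparallel W
      (hU.fieldDiffAt x) hz, he, h W U hW hU x z' hz', neg_zero]
  · rw [LightlikeGeometry.LightlikeSubmanifold.shapeStar_eq_zero_iff,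
      LightlikeGeometry.LightlikeSubmanifold.indConn_mem_rad_iff]
    exact h W U hW hU x
  rintro (h | h | h) W U hW hU x z hz
  · have h0 := (h W U hW hU x).2
    rw [LightlikeGeometry.LightlikeSubmanifold.shapeStar_eq_zero_iff,
      LightlikeGeometry.LightlikeSubmanifold.indConn_mem_rad_iff] at h0
    exact h0 z hz
  · have key {z : LightlikeGeometry.Tan E x} (hz : z ∈ L.screen x) :
        g.form (L.f x) (LightlikeGeometry.covAlong cov L.f (L.push U) x (W x))
            (J.endo (L.f x) (L.df x z))
          = p * g.form (L.f x) (LightlikeGeometry.covAlong cov L.f (L.push U) x (W x))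
            (L.df x z) := by
      have h1 := LightlikeGeometry.LightlikeSubmanifold.form_shape hmetallic hparallel W
        (hU.fieldDiffAt x) hz
      rw [h W U hW hU x, map_smul, map_smul, smul_apply, smul_eq_mul,
        LightlikeGeometry.LightlikeSubmanifold.form_shapeStar W U hz] at h1
      linarith
    -- Using `key` at z' = Jz instead of z makes J² appear; the terms pω(Jz) cancel and qω(z) = 0
    -- remains.
    obtain ⟨z', hz', he⟩ := hL.exists_endo_df hz
    have h1 := key hz'
    rw [← he, hsq] at h1
    have hq : (q : ℝ) ≠ 0 := by exact_mod_cast hmetallic.q_pos.ne'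
    exact (mul_eq_zero.1 (by linarith : (q : ℝ) * g.form (L.f x)
      (LightlikeGeometry.covAlong cov L.f (L.push U) x (W x)) (L.df x z) = 0)).resolve_left hq
  -- Write z = J²z₂ with z₂ in the screen. Condition (iii) concerns sections, so z₂ is extended to a
  -- global section `Z`.
  · obtain ⟨z₁, hz₁, h₁⟩ := hL.exists_df_eq_endo hz
    obtain ⟨z₂, hz₂, h₂⟩ := hL.exists_df_eq_endo hz₁
    obtain ⟨Z, hZ, rfl⟩ := L.smooth_screen.exists_isSection hz₂
    have h3 := LightlikeGeometry.LightlikeSubmanifold.form_hs hcov hmetallic hparallel hL W hU hZ x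
    rw [h W Z hW hZ x (L.endoPush J U x) ⟨_, ⟨U x, hU.mem x, rfl⟩, rfl⟩, ← h₂, ← h₁] at h3
    linarith
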